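/- For a real $d\times n$ matrix $a=(a_{ij})$, $b\in\mathbf R^n$ and $x\in\mathbf R^d$ put $f_j(a,b,x)=\sum_{i=1}^d a_{ij}x_i+b_j$ $(1\le j\le n)$. Let $$P(a,b)=\{x\in\mathbf R^d : f_j(a,b,x)\ge 0,\ 1\le j\le n\},\qquad F_j(a,b)=\{x\in P(a,b) : f_j(a,b,x)=0\},$$ and let $$\mathcal F(a,b)=\Bigl\{J\subset\{1,\dots,n\} : P(a,b)\cap\bigcap_{j\in J}F_j(a,b)\ne\emptyset\Bigr\}$$ be the abstract simplicial complex of $P(a,b)$. Let $H(t)=1$ for $t\ge 0$ and $H(t)=0$ for $t<0$. On $\mathbf R\times\mathbf R^d$ consider the homogenized linear forms $\hat f_0(x_0,x)=x_0$ and $\hat f_j(x_0,x)=\sum_{i=1}^d a_{ij}x_i+b_jx_0$ $(1\le j\le n)$, and the cone $\hat P(a,b)=\{\hat f_0\ge 0,\dots,\hat f_n\ge 0\}$. The polyhedron $P(a,b)$ (with its system of inequalities) is in general position if, for every $K\subset\{0,1,\dots,n\}$ such that the forms $\hat f_k$, $k\in K$, have a common nonzero zero in $\hat P(a,b)$, the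 subspace $\{\hat f_k=0,\ k\in K\}$ of $\mathbf R\times\mathbf R^{d}$ has dimension $d+1-|K|$. Theorem. Let $(\tilde a,\tilde b)\in\mathbf R^{d\times n}\times\mathbf R^n$ be such that $P(\tilde a,\tilde b)$ is in general position, put $\mathcal F=\mathcal F(\tilde a,\tilde b)$, and let $J\in\mathcal F$. Then there is a neighborhood $U$ of $(\tilde a,\tilde b)$ in $\mathbf R^{d\times n}\times\mathbf R^n$ such that, for every $(a,b)\in U$ and every $x\in\mathbf R^d$ with $f_j(a,b,x)=0$ for all $j\in J$, $$\prod_{j\in\{1,\dots,n\}\setminus J}H(f_j(a,b,x))=\sum_{F\in\mathcal F,\ J\subset F}\ \prod_{j\in F\setminus J}\bigl(H(f_j(a,b,x))-1\bigr).$$ -/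

import Mathlib

open scoped Topology

namespace HalfSpaces

/-- The affine function `f_j(a, b, x) = ∑ i, a i j * x i + b j` on `ℝ^d`. -/
def form {d n : ℕ} (a : Matrix (Fin d) (Fin n) ℝ) (b : Fin n → ℝ) (j : Fin n)
    (x : Fin d → ℝ) : ℝ :=
  ∑ i, a i j * x i + b j

/-- The closed half-space `H_j(a, b)`. -/
def halfSpace {d n : ℕ} (a : Matrix (Fin d) (Fin n) ℝ) (b : Fin n → ℝ) (j : Fin n) :
    Set (Fin d → ℝ) :=
  {x | 0 ≤ form a b j x}

/-- The polyhedron `P(a, b)`, the intersection of the half-spaces `H_j(a, b)`. -/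
def polyhedron {d n : ℕ} (a : Matrix (Fin d) (Fin n) ℝ) (b : Fin n → ℝ) : Set (Fin d → ℝ) :=
  ⋂ j, halfSpace a b j

/-- The part `F_j(a, b)` of the polyhedron that lies on the hyperplane bounding `H_j(a, b)`. -/
def facet {d n : ℕ} (a : Matrix (Fin d) (Fin n) ℝ) (b : Fin n → ℝ) (j : Fin n) :
    Set (Fin d → ℝ) :=
  {x | form a b j x = 0} ∩ polyhedron a b

/-- The abstract simplicial complex of the polyhedron, the nerve of its facets. The intersection
is taken inside the polyhedron, so that the empty set is a simplex exactly when the polyhedron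
is nonempty. -/
def simplicialComplex {d n : ℕ} (a : Matrix (Fin d) (Fin n) ℝ) (b : Fin n → ℝ) :
    Set (Finset (Fin n)) :=
  {J | (polyhedron a b ∩ ⋂ j ∈ J, facet a b j).Nonempty}

open scoped Classical in
/-- The set of the simplices that contain `J`. -/
noncomputable def simplicesAbove {d n : ℕ} (a : Matrix (Fin d) (Fin n) ℝ) (b : Fin n → ℝ)
    (J : Finset (Fin n)) : Finset (Finset (Fin n)) :=
  {F | F ∈ simplicialComplex a b ∧ J ⊆ F}

/-- The affine subspace `V(J, a, b)` on which all `f_j`, `j ∈ J`, vanish. -/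
def flat {d n : ℕ} (J : Finset (Fin n)) (a : Matrix (Fin d) (Fin n) ℝ) (b : Fin n → ℝ) :
    Set (Fin d → ℝ) :=
  {x | ∀ j ∈ J, form a b j x = 0}

/-- The Heaviside function, the indicator function of `[0, ∞)`. -/
noncomputable def heaviside (t : ℝ) : ℝ := if 0 ≤ t then 1 else 0

/-- The homogenized linear forms on `ℝ × ℝ^d`. The index `some j` stands for
`(x₀, x) ↦ ∑ i, a i j * x i + b j * x₀`, and the index `none` for `(x₀, x) ↦ x₀`, whose zero set
is the hyperplane at infinity. -/
noncomputable def homForm {d n : ℕ} (a : Matrix (Fin d) (Fin n) ℝ) (b : Fin n → ℝ) :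
    Option (Fin n) → (ℝ × (Fin d → ℝ)) →ₗ[ℝ] ℝ
  | none => LinearMap.fst ℝ ℝ (Fin d → ℝ)
  | some j =>
      (∑ i, a i j • (LinearMap.proj i).comp (LinearMap.snd ℝ ℝ (Fin d → ℝ)))
        + b j • LinearMap.fst ℝ ℝ (Fin d → ℝ)

/-- The homogenized polyhedron, a closed polyhedral cone in `ℝ × ℝ^d`. -/
def homCone {d n : ℕ} (a : Matrix (Fin d) (Fin n) ℝ) (b : Fin n → ℝ) :
    Set (ℝ × (Fin d → ℝ)) :=
  {y | ∀ k, 0 ≤ homForm a b k y}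

/-- The polyhedron is in general position: whenever some of its bounding hyperplanes, the
hyperplane at infinity included, have a common point in the projective completion of the
polyhedron (that is, a common nonzero point in the homogenized cone), the codimension of
their intersection is their number. -/
def InGeneralPosition {d n : ℕ} (a : Matrix (Fin d) (Fin n) ℝ) (b : Fin n → ℝ) : Prop :=
  ∀ K : Finset (Option (Fin n)),
    (∃ y ∈ homCone a b, y ≠ 0 ∧ ∀ k ∈ K, homForm a b k y = 0) →
      Module.finrank ℝ (⨅ k ∈ K, LinearMap.ker (homForm a b k) :
        Submodule ℝ (ℝ × (Fin d → ℝ))) + K.card = d + 1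

end HalfSpaces

namespace HalfSpaces

/-! Let `N` be the set of indices with `f_j(x) < 0`. The left side is 1 or 0 according as `N` is
empty or not. The right side is the sum of `(-1)^|F|` over `F ⊆ N` with `J ∪ F` a simplex of the
unperturbed polyhedron. If that complex is replaced by the complex of the perturbed polyhedron,
equality holds without general position (`altSum_negIndices`). Move `x` towards a point of the face
of `J`: `N` loses a nonempty set `Z` at the first crossing `z`. By induction on `|N|`, the sums over
the remaining indices are the same for all `J ∪ S`, `S ⊆ Z`, so adjoining `Z` cancels them. General
position serves only to keep the complex constant near `(a₀, b₀)`
(`InGeneralPosition.eventually_simplicialComplex_eq`): simplices persist by solving a nonsingular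
linear system, and non-simplices persist by compactness of the projective completion. -/

/-! ### Alternating sums over a family of finite sets -/

open scoped Classical in
/-- The alternating sum of the sets `F ⊆ N` for which `J ∪ F` belongs to the family `C`. -/
noncomputable def altSum {α : Type*} [DecidableEq α] (C : Set (Finset α)) (J N : Finset α) : ℝ :=
  ∑ F ∈ N.powerset, if J ∪ F ∈ C then (-1) ^ F.card else 0

open scoped Classical in
theorem altSum_empty {α : Type*} [DecidableEq α] (C : Set (Finset α)) (J : Finset α) :
    altSum C J ∅ = if J ∈ C then 1 else 0 := by
  simp [altSum]

-- Sort the subsets of `insert k N` by whether they contain `k`; removing `k` flips the sign.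
open scoped Classical in
theorem altSum_insert {α : Type*} [DecidableEq α] (C : Set (Finset α)) (J N : Finset α)
    {k : α} (hk : k ∉ N) :
    altSum C J (insert k N) = altSum C J N - altSum C (insert k J) N := by
  unfold altSum
  rw [Finset.sum_powerset_insert hk, sub_eq_add_neg, ← Finset.sum_neg_distrib]
  congr 1
  refine Finset.sum_congr rfl fun F hF => ?_
  have hkF : k ∉ F := fun h => hk (Finset.mem_powerset.1 hF h)
  rw [Finset.card_insert_of_notMem hkF, Finset.union_insert, Finset.insert_union]
  split_ifs <;> ring

open scoped Classical in
/-- If the alternating sums over `M` do not depend on which elements of `Z` are put into `J`, then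
those over `M ∪ Z` vanish unless `Z` is empty. -/
theorem altSum_union {α : Type*} [DecidableEq α] (C : Set (Finset α)) (c : ℝ) (M Z : Finset α)
    (hd : Disjoint M Z) : ∀ J : Finset α, (∀ S ⊆ Z, altSum C (J ∪ S) M = c) →
      altSum C J (M ∪ Z) = if Z = ∅ then c else 0 := by
  induction Z using Finset.induction_on with
  | empty => intro J h; simpa using h ∅ (Finset.Subset.refl _)
  | insert k Z hk ih =>
    intro J h
    rw [Finset.disjoint_insert_right] at hd
    -- Both terms of the difference satisfy the induction hypothesis with the same `c`, so they
    -- cancel.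
    rw [Finset.union_insert, altSum_insert C J _ (by simp [hd.1, hk]),
      ih hd.2 J fun S hS => h S (hS.trans (Finset.subset_insert _ _)),
      ih hd.2 (insert k J) fun S hS => by
        rw [Finset.insert_union, ← Finset.union_insert]
        exact h _ (Finset.insert_subset_insert _ hS)]
    simp

theorem altSum_eq_zero {α : Type*} [DecidableEq α] (C : Set (Finset α))
    (hC : ∀ F ∈ C, ∀ G ⊆ F, G ∈ C)
    {J : Finset α} (hJ : J ∉ C) (N : Finset α) : altSum C J N = 0 := by
  refine Finset.sum_eq_zero fun F _ => if_neg fun h => hJ (hC _ h _ ?_)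
  exact Finset.subset_union_left

/-! ### The Euler relation for visible faces -/

variable {d n : ℕ}

theorem mem_simplicialComplex {a : Matrix (Fin d) (Fin n) ℝ} {b : Fin n → ℝ}
    {F : Finset (Fin n)} :
    F ∈ simplicialComplex a b ↔ ∃ x, (∀ j, 0 ≤ form a b j x) ∧ ∀ j ∈ F, form a b j x = 0 := by
  simp only [simplicialComplex, Set.mem_ofPred_eq, Set.Nonempty, polyhedron, halfSpace, facet,
    Set.mem_inter_iff, Set.mem_iInter]
  exact exists_congr fun x => ⟨fun h => ⟨h.1, fun j hj => (h.2 j hj).1⟩,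
    fun h => ⟨h.1, fun j hj => ⟨h.2 j hj, h.1⟩⟩⟩

theorem simplicialComplex_mono {a : Matrix (Fin d) (Fin n) ℝ} {b : Fin n → ℝ}
    {F G : Finset (Fin n)} (hF : F ∈ simplicialComplex a b) (hG : G ⊆ F) :
    G ∈ simplicialComplex a b := by
  obtain ⟨x, hx, hxF⟩ := mem_simplicialComplex.1 hF
  exact mem_simplicialComplex.2 ⟨x, hx, fun j hj => hxF j (hG hj)⟩

theorem form_lineMap (a : Matrix (Fin d) (Fin n) ℝ) (b : Fin n → ℝ) (j : Fin n)
    (x y : Fin d → ℝ) (t : ℝ) :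
    form a b j (x + t • (y - x)) = form a b j x + t * (form a b j y - form a b j x) := by
  simp only [form, Pi.add_apply, Pi.smul_apply, Pi.sub_apply, smul_eq_mul]
  rw [add_sub_add_right_eq_sub, ← Finset.sum_sub_distrib, Finset.mul_sum, add_right_comm,
    ← Finset.sum_add_distrib]
  congr 1
  exact Finset.sum_congr rfl fun i _ => by ring

/-- The indices of the half-spaces that do not contain `x`. -/
noncomputable def negIndices (a : Matrix (Fin d) (Fin n) ℝ) (b : Fin n → ℝ) (x : Fin d → ℝ) :
    Finset (Fin n) :=
  {j | form a b j x < 0}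

theorem mem_negIndices {a : Matrix (Fin d) (Fin n) ℝ} {b : Fin n → ℝ} {x : Fin d → ℝ}
    {j : Fin n} : j ∈ negIndices a b x ↔ form a b j x < 0 := by
  simp [negIndices]

/-- On the way from `x` to a point `y` of the polyhedron, some of the hyperplanes that separate
`x` from it are met first. -/
theorem exists_first_crossing {a : Matrix (Fin d) (Fin n) ℝ} {b : Fin n → ℝ} {x y : Fin d → ℝ}
    (hx : (negIndices a b x).Nonempty) (hy : ∀ j, 0 ≤ form a b j y) :
    ∃ (z : Fin d → ℝ) (Z : Finset (Fin n)), Z.Nonempty ∧ Disjoint (negIndices a b z) Z ∧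
      negIndices a b x = negIndices a b z ∪ Z ∧ (∀ j ∈ Z, form a b j z = 0) ∧
      ∀ j, form a b j x = 0 → form a b j y = 0 → form a b j z = 0 := by
  -- The quotient is the time at which `form a b j` vanishes on the segment from `x` to `y`; `k`
  -- attains the earliest.
  obtain ⟨k, hk, hmin⟩ := Finset.exists_min_image (negIndices a b x)
    (fun j => -form a b j x / (form a b j y - form a b j x)) hx
  set t := -form a b k x / (form a b k y - form a b k x) with ht
  have hk' := mem_negIndices.1 hk
  have hkd : 0 < form a b k y - form a b k x := by linarith [hy k]
  have ht0 : 0 ≤ t := div_nonneg (by linarith) hkd.le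
  have ht1 : t ≤ 1 := (div_le_one hkd).2 (by linarith [hy k])
  have hneg : ∀ j ∈ negIndices a b x, form a b j (x + t • (y - x)) ≤ 0 := fun j hj => by
    have hj' := mem_negIndices.1 hj
    have := (le_div_iff₀ (by linarith [hy j])).1 (hmin j hj)
    rw [form_lineMap]
    linarith
  have hpos : ∀ j, 0 ≤ form a b j x → 0 ≤ form a b j (x + t • (y - x)) := fun j hj => by
    rw [form_lineMap]
    nlinarith [hy j, mul_nonneg ht0 (hy j), mul_nonneg (sub_nonneg.2 ht1) hj]
  refine ⟨x + t • (y - x), {j ∈ negIndices a b x | form a b j (x + t • (y - x)) = 0},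
    ⟨k, Finset.mem_filter.2 ⟨hk, ?_⟩⟩, ?_, ?_, fun j hj => (Finset.mem_filter.1 hj).2, ?_⟩
  · rw [form_lineMap, ht, div_mul_cancel₀ _ hkd.ne', add_neg_cancel]
  · refine Finset.disjoint_left.2 fun j hj hj' => ?_
    exact (mem_negIndices.1 hj).ne (Finset.mem_filter.1 hj').2
  · ext j
    rw [Finset.mem_union, Finset.mem_filter, mem_negIndices (x := x + t • (y - x))]
    refine ⟨fun hj => (hneg j hj).lt_or_eq.imp id fun h => ⟨hj, h⟩, ?_⟩
    rintro (h | h)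
    · exact mem_negIndices.2 (not_le.1 fun h' => (hpos j h').not_gt h)
    · exact h.1
  · intro j h h'
    rw [form_lineMap, h, h']
    ring

/-- The Euler relation for the faces that are visible from a point `x`. -/
theorem altSum_negIndices (a : Matrix (Fin d) (Fin n) ℝ) (b : Fin n → ℝ) (J : Finset (Fin n))
    (x : Fin d → ℝ) (hx : x ∈ flat J a b) :
    altSum (simplicialComplex a b) J (negIndices a b x) =
      if negIndices a b x = ∅ then 1 else 0 := by
  classical
  induction hm : (negIndices a b x).card using Nat.strong_induction_on generalizing J x with
  | _ m ih =>
  rcases (negIndices a b x).eq_empty_or_nonempty with h | hne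
  · have hJ : J ∈ simplicialComplex a b := mem_simplicialComplex.2
      ⟨x, fun j => not_lt.1 fun hj => by simpa [h] using mem_negIndices.2 hj, hx⟩
    rw [h, altSum_empty, if_pos hJ, if_pos rfl]
  · rw [if_neg hne.ne_empty]
    by_cases hJ : J ∈ simplicialComplex a b
    · obtain ⟨y, hy, hyJ⟩ := mem_simplicialComplex.1 hJ
      obtain ⟨z, Z, hZ, hd, hN, hzZ, hz⟩ := exists_first_crossing hne hy
      -- The point `z` lies on the flat of `J ∪ S` for every `S ⊆ Z`, so the induction hypothesis at
      -- `z` gives a value independent of `S`.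
      rw [hN, altSum_union _ (if negIndices a b z = ∅ then 1 else 0) _ _ hd, if_neg hZ.ne_empty]
      intro S hS
      refine ih _ ?_ _ _ ?_ rfl
      · rw [← hm, hN, Finset.card_union_of_disjoint hd]
        exact Nat.lt_add_of_pos_right hZ.card_pos
      · intro j hj
        rcases Finset.mem_union.1 hj with hj | hj
        · exact hz j (hx j hj) (hyJ j hj)
        · exact hzZ j (hS hj)
    · exact altSum_eq_zero _ (fun F hF G hG => simplicialComplex_mono hF hG) hJ _

/-! ### Both sides of the identity in terms of negative indices -/

theorem heaviside_sub_one (t : ℝ) : heaviside t - 1 = if t < 0 then -1 else 0 := by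
  rw [heaviside]
  rcases lt_or_ge t 0 with h | h
  · simp [h, h.not_ge]
  · simp [h, h.not_gt]

/-- Each factor is -1 at a negative index and 0 elsewhere, so only `F` with `F \ J` inside the
negative indices contribute; these avoid `J`, whence `F ↦ F \ J` is a bijection. -/
theorem sum_simplicesAbove_eq_altSum (a : Matrix (Fin d) (Fin n) ℝ) (b : Fin n → ℝ)
    (a' : Matrix (Fin d) (Fin n) ℝ) (b' : Fin n → ℝ) (J : Finset (Fin n))
    (x : Fin d → ℝ) (hx : x ∈ flat J a b) :
    ∑ F ∈ simplicesAbove a' b' J, ∏ j ∈ F \ J, (heaviside (form a b j x) - 1) =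
      altSum (simplicialComplex a' b') J (negIndices a b x) := by
  classical
  have hd : Disjoint (negIndices a b x) J := Finset.disjoint_left.2 fun j hj hj' =>
    (mem_negIndices.1 hj).ne (hx j hj')
  have hprod : ∀ F : Finset (Fin n), ∏ j ∈ F, (heaviside (form a b j x) - 1) =
      if F ⊆ negIndices a b x then (-1) ^ F.card else 0 := fun F => by
    split_ifs with h
    · refine Finset.prod_eq_pow_card fun j hj => ?_
      rw [heaviside_sub_one, if_pos (mem_negIndices.1 (h hj))]
    · obtain ⟨j, hj, hj'⟩ := Finset.not_subset.1 h
      refine Finset.prod_eq_zero hj ?_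
      rw [heaviside_sub_one, if_neg fun h => hj' (mem_negIndices.2 h)]
  simp only [hprod, altSum]
  rw [← Finset.sum_filter, ← Finset.sum_filter]
  refine Finset.sum_nbij' (fun F => F \ J) (fun F => J ∪ F) ?_ ?_ ?_ ?_ fun _ _ => rfl
  · intro F hF
    simp only [simplicesAbove, Finset.mem_filter, Finset.mem_univ, true_and] at hF
    simp only [Finset.mem_filter, Finset.mem_powerset]
    exact ⟨hF.2, by rw [Finset.union_sdiff_of_subset hF.1.2]; exact hF.1.1⟩
  · intro F hF
    simp only [Finset.mem_filter, Finset.mem_powerset] at hF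
    simp only [simplicesAbove, Finset.mem_filter, Finset.mem_univ, true_and]
    refine ⟨⟨hF.2, Finset.subset_union_left⟩, ?_⟩
    rw [Finset.union_sdiff_left]
    exact Finset.sdiff_subset.trans hF.1
  · intro F hF
    simp only [simplicesAbove, Finset.mem_filter, Finset.mem_univ, true_and] at hF
    exact Finset.union_sdiff_of_subset hF.1.2
  · intro F hF
    simp only [Finset.mem_filter, Finset.mem_powerset] at hF
    rw [Finset.union_sdiff_left]
    exact Finset.sdiff_eq_self_of_disjoint (hd.mono_left hF.1)

theorem prod_heaviside_eq (a : Matrix (Fin d) (Fin n) ℝ) (b : Fin n → ℝ) (J : Finset (Fin n))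
    (x : Fin d → ℝ) (hx : x ∈ flat J a b) :
    ∏ j ∈ Finset.univ \ J, heaviside (form a b j x) =
      if negIndices a b x = ∅ then 1 else 0 := by
  split_ifs with h
  · refine Finset.prod_eq_one fun j _ => if_pos (not_lt.1 fun hj => ?_)
    simpa [h] using mem_negIndices.2 hj
  · obtain ⟨j, hj⟩ := Finset.nonempty_iff_ne_empty.2 h
    have hj' := mem_negIndices.1 hj
    refine Finset.prod_eq_zero (i := j) ?_ (if_neg hj'.not_ge)
    simpa using fun h => hj'.ne (hx j h)

/-! ### Homogenization and general position -/

theorem homForm_some_apply (a : Matrix (Fin d) (Fin n) ℝ) (b : Fin n → ℝ) (j : Fin n)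
    (y : ℝ × (Fin d → ℝ)) : homForm a b (some j) y = ∑ i, a i j * y.2 i + b j * y.1 := by
  simp [homForm]

theorem homForm_none_apply (a : Matrix (Fin d) (Fin n) ℝ) (b : Fin n → ℝ)
    (y : ℝ × (Fin d → ℝ)) : homForm a b none y = y.1 := rfl

theorem homForm_one (a : Matrix (Fin d) (Fin n) ℝ) (b : Fin n → ℝ) (j : Fin n)
    (x : Fin d → ℝ) : homForm a b (some j) (1, x) = form a b j x := by
  simp [homForm_some_apply, form]

theorem continuousAt_homForm {X : Type*} [TopologicalSpace X] {p : X}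
    {A : X → Matrix (Fin d) (Fin n) ℝ} {B : X → Fin n → ℝ} {y : X → ℝ × (Fin d → ℝ)}
    (k : Option (Fin n)) (hA : ContinuousAt A p) (hB : ContinuousAt B p)
    (hy : ContinuousAt y p) : ContinuousAt (fun q => homForm (A q) (B q) k (y q)) p := by
  rcases k with _ | j
  · simp only [homForm_none_apply]
    exact hy.fst
  · simp only [homForm_some_apply]
    have h1 : ∀ i, ContinuousAt (fun q => A q i j) p := fun i =>
      continuousAt_pi.1 (continuousAt_pi.1 hA i) j
    have h2 := continuousAt_pi.1 hB j
    fun_prop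

theorem continuous_homForm {X : Type*} [TopologicalSpace X]
    {A : X → Matrix (Fin d) (Fin n) ℝ} {B : X → Fin n → ℝ} {y : X → ℝ × (Fin d → ℝ)}
    (k : Option (Fin n)) (hA : Continuous A) (hB : Continuous B) (hy : Continuous y) :
    Continuous fun q => homForm (A q) (B q) k (y q) :=
  continuous_iff_continuousAt.2 fun _ =>
    continuousAt_homForm k hA.continuousAt hB.continuousAt hy.continuousAt

theorem mem_simplicialComplex_of_homCone {a : Matrix (Fin d) (Fin n) ℝ} {b : Fin n → ℝ}
    {F : Finset (Fin n)} {y : ℝ × (Fin d → ℝ)} (hy0 : 0 < y.1) (hy : y ∈ homCone a b)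
    (hF : ∀ j ∈ F, homForm a b (some j) y = 0) : F ∈ simplicialComplex a b := by
  have h : ∀ j, form a b j (y.1⁻¹ • y.2) = y.1⁻¹ * homForm a b (some j) y := fun j => by
    rw [← homForm_one, ← smul_eq_mul, ← map_smul]
    congr 1
    ext1
    · simp [hy0.ne']
    · rfl
  refine mem_simplicialComplex.2 ⟨y.1⁻¹ • y.2, fun j => ?_, fun j hj => ?_⟩
  · rw [h]
    exact mul_nonneg (inv_nonneg.2 hy0.le) (hy _)
  · rw [h, hF j hj, mul_zero]

theorem homCone_of_form_nonneg {a : Matrix (Fin d) (Fin n) ℝ} {b : Fin n → ℝ} {x : Fin d → ℝ}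
    (hx : ∀ j, 0 ≤ form a b j x) : ((1, x) : ℝ × (Fin d → ℝ)) ∈ homCone a b := by
  rintro (_ | j)
  · exact zero_le_one
  · rw [homForm_one]
    exact hx j

/-- Linear forms whose common kernel has the smallest possible dimension have a dual system. -/
theorem exists_dual_system {V ι : Type*} [AddCommGroup V] [Module ℝ V] [FiniteDimensional ℝ V]
    [DecidableEq ι] (f : ι → V →ₗ[ℝ] ℝ) (K : Finset ι)
    (h : Module.finrank ℝ (⨅ k ∈ K, LinearMap.ker (f k) : Submodule ℝ V) + K.card =
      Module.finrank ℝ V) :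
    ∃ v : K → V, ∀ k l : K, f k (v l) = if k = l then 1 else 0 := by
  have hker : LinearMap.ker (LinearMap.pi fun k : K => f k) = ⨅ k ∈ K, LinearMap.ker (f k) := by
    rw [LinearMap.ker_pi, iInf_subtype]
  have hsurj : Function.Surjective (LinearMap.pi fun k : K => f k) := by
    rw [← LinearMap.range_eq_top]
    apply Submodule.eq_top_of_finrank_eq
    have := LinearMap.finrank_range_add_finrank_ker (LinearMap.pi fun k : K => f k)
    rw [hker] at this
    rw [Module.finrank_fintype_fun_eq_card, Fintype.card_coe]
    omega
  choose v hv using fun l : K => hsurj (Pi.single l 1)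
  refine ⟨v, fun k l => ?_⟩
  have := congrFun (hv l) k
  rwa [LinearMap.pi_apply, Pi.single_apply] at this

theorem InGeneralPosition.exists_dual_system {a : Matrix (Fin d) (Fin n) ℝ} {b : Fin n → ℝ}
    (hP : InGeneralPosition a b) {y : ℝ × (Fin d → ℝ)} (hy : y ∈ homCone a b) (hy0 : y ≠ 0)
    (K : Finset (Option (Fin n))) (hK : ∀ k ∈ K, homForm a b k y = 0) :
    ∃ v : K → ℝ × (Fin d → ℝ), ∀ k l : K, homForm a b k (v l) = if k = l then 1 else 0 := by
  refine HalfSpaces.exists_dual_system (homForm a b) K ?_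
  rw [hP K ⟨y, hy, hy0, hK⟩]
  simp [add_comm]

/-- In general position, a face of the projective completion is not contained in the hyperplane
at infinity. -/
theorem InGeneralPosition.mem_simplicialComplex {a : Matrix (Fin d) (Fin n) ℝ} {b : Fin n → ℝ}
    (hP : InGeneralPosition a b) {y : ℝ × (Fin d → ℝ)} (hy : y ∈ homCone a b) (hy0 : y ≠ 0)
    {F : Finset (Fin n)} (hF : ∀ j ∈ F, homForm a b (some j) y = 0) :
    F ∈ simplicialComplex a b := by
  classical
  rcases (hy none).lt_or_eq with hpos | hzero
  · exact mem_simplicialComplex_of_homCone hpos hy hF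
  obtain ⟨v, hv⟩ := hP.exists_dual_system hy hy0 {k | homForm a b k y = 0} (by simp)
  have hmem : ∀ k, homForm a b k y = 0 →
      k ∈ ({k | homForm a b k y = 0} : Finset (Option (Fin n))) := by simp
  -- The direction `w` leaves the hyperplane at infinity but stays on every other hyperplane through
  -- `y`; a small step along it remains in the cone.
  set w := v ⟨none, hmem none hzero.symm⟩ with hw
  have hwk : ∀ k, homForm a b k y = 0 → homForm a b k w = if k = none then 1 else 0 :=
    fun k hk => by simpa using hv ⟨k, hmem k hk⟩ ⟨none, hmem none hzero.symm⟩
  have hev : ∀ᶠ ε : ℝ in 𝓝[>] 0, ∀ k, homForm a b k y ≠ 0 → 0 < homForm a b k (y + ε • w) := by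
    refine nhdsWithin_le_nhds (Filter.eventually_all.2 fun k => ?_)
    by_cases hk : homForm a b k y = 0
    · simp [hk]
    have hc : ContinuousAt (fun ε : ℝ => homForm a b k (y + ε • w)) 0 := by
      simp only [map_add, map_smul, smul_eq_mul]
      fun_prop
    refine (hc.eventually (lt_mem_nhds (a := 0) ?_)).mono fun ε hε _ => hε
    simpa using lt_of_le_of_ne (hy k) (Ne.symm hk)
  obtain ⟨ε, hε, hε0⟩ := (hev.and self_mem_nhdsWithin).exists
  have hzk : ∀ k, homForm a b k y = 0 →
      homForm a b k (y + ε • w) = if k = none then ε else 0 := fun k hk => by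
    rw [map_add, map_smul, hk, hwk k hk]
    simp
  refine mem_simplicialComplex_of_homCone (y := y + ε • w) ?_ (fun k => ?_) fun j hj => ?_
  · have := hzk none hzero.symm
    rw [homForm_none_apply, if_pos rfl] at this
    rw [this]
    exact hε0
  · by_cases hk : homForm a b k y = 0
    · rw [hzk k hk]
      split_ifs
      exacts [le_of_lt hε0, le_rfl]
    · exact (hε k hk).le
  · rw [hzk _ (hF j hj), if_neg (by simp)]

/-! ### Stability of the simplicial complex -/

/-- A common zero of finitely many linear forms, which depend continuously on a parameter and have
a dual system at one parameter, extends continuously to nearby parameters. -/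
theorem exists_continuousAt_zero {X V ι : Type*} [TopologicalSpace X] [AddCommGroup V]
    [Module ℝ V] [TopologicalSpace V] [IsTopologicalAddGroup V] [ContinuousSMul ℝ V]
    [Fintype ι] [DecidableEq ι] (f : X → ι → V →ₗ[ℝ] ℝ)
    (hf : ∀ k y, Continuous fun p => f p k y) (p₀ : X) (v : ι → V)
    (hv : ∀ k l, f p₀ k (v l) = if k = l then 1 else 0) (y : V) (hy : ∀ k, f p₀ k y = 0) :
    ∃ z : X → V, ContinuousAt z p₀ ∧ z p₀ = y ∧ ∀ᶠ p in 𝓝 p₀, ∀ k, f p k (z p) = 0 := by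
  set M : X → Matrix ι ι ℝ := fun p => Matrix.of fun k l => f p k (v l) with hM
  have hMc : Continuous M := continuous_matrix fun k l => hf k (v l)
  have hM0 : M p₀ = 1 := by
    ext k l
    simp [hM, hv, Matrix.one_apply]
  have hdet : ContinuousAt (fun p => (M p).det) p₀ := hMc.matrix_det.continuousAt
  have hdet0 : (M p₀).det ≠ 0 := by simp [hM0]
  -- Cramer's rule: `c p` solves `M p * c = f p y`, so subtracting `∑ c_l v_l` from `y` kills all
  -- the forms.
  let c : X → ι → ℝ := fun p => ((M p).det)⁻¹ • ((M p).adjugate.mulVec fun k => f p k y)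
  have hc : ContinuousAt c p₀ := by
    refine (hdet.inv₀ hdet0).smul (Continuous.continuousAt ?_)
    exact hMc.matrix_adjugate.matrix_mulVec (continuous_pi fun k => hf k y)
  refine ⟨fun p => y - ∑ l, c p l • v l, ?_, ?_, ?_⟩
  · refine continuousAt_const.sub (tendsto_finsetSum _ fun l _ => ?_)
    exact ((continuousAt_pi.1 hc l).smul continuousAt_const)
  · have : (fun k => f p₀ k y) = 0 := funext hy
    simp [c, this]
  · filter_upwards [hdet.eventually_ne hdet0] with p hp k
    have h1 : (M p).mulVec (c p) = fun k => f p k y := by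
      simp only [c]
      rw [Matrix.mulVec_smul, Matrix.mulVec_mulVec, Matrix.mul_adjugate, Matrix.smul_mulVec,
        Matrix.one_mulVec, smul_smul, inv_mul_cancel₀ hp, one_smul]
    have h2 := congrFun h1 k
    simp only [Matrix.mulVec, dotProduct, hM, Matrix.of_apply] at h2
    rw [map_sub, map_sum, ← h2, sub_eq_zero]
    exact Finset.sum_congr rfl fun l _ => by rw [map_smul, smul_eq_mul, mul_comm]

/-- A point of the face is carried along continuously, keeping all the forms that vanish there at
zero; the others, `x₀` among them, stay positive. -/
theorem InGeneralPosition.eventually_mem_simplicialComplex {a₀ : Matrix (Fin d) (Fin n) ℝ}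
    {b₀ : Fin n → ℝ} (hP : InGeneralPosition a₀ b₀) {F : Finset (Fin n)}
    (hF : F ∈ simplicialComplex a₀ b₀) :
    ∀ᶠ p in 𝓝 (a₀, b₀), F ∈ simplicialComplex p.1 p.2 := by
  classical
  obtain ⟨x, hx, hxF⟩ := HalfSpaces.mem_simplicialComplex.1 hF
  have hy := homCone_of_form_nonneg hx
  set K : Finset (Option (Fin n)) := {k | homForm a₀ b₀ k (1, x) = 0} with hK
  obtain ⟨v, hv⟩ := hP.exists_dual_system hy (by simp) K (by simp [hK])
  obtain ⟨z, hz, hz0, hzK⟩ := exists_continuousAt_zero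
    (fun (p : Matrix (Fin d) (Fin n) ℝ × (Fin n → ℝ)) (k : K) => homForm p.1 p.2 k)
    (fun k y => continuous_homForm (k : Option (Fin n)) continuous_fst continuous_snd
      continuous_const) (a₀, b₀) v hv (1, x)
    (fun k => (Finset.mem_filter.1 k.2).2)
  have hpos : ∀ᶠ p in 𝓝 (a₀, b₀), ∀ k, k ∉ K → 0 < homForm p.1 p.2 k (z p) := by
    refine Filter.eventually_all.2 fun k => ?_
    by_cases hk : k ∈ K
    · simp [hk]
    have hc : ContinuousAt (fun p : Matrix (Fin d) (Fin n) ℝ × (Fin n → ℝ) =>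
        homForm p.1 p.2 k (z p)) (a₀, b₀) :=
      continuousAt_homForm k continuousAt_fst continuousAt_snd hz
    refine (hc.eventually (lt_mem_nhds (a := 0) ?_)).mono fun p hp _ => hp
    simp only [hz0]
    exact lt_of_le_of_ne (hy k) fun h => hk (by simpa [hK] using h.symm)
  filter_upwards [hzK, hpos] with p h0 h1
  refine mem_simplicialComplex_of_homCone (y := z p) ?_ (fun k => ?_) fun j hj => ?_
  · exact h1 none (by simp [hK, homForm_none_apply])
  · by_cases hk : k ∈ K
    exacts [(h0 ⟨k, hk⟩).ge, (h1 k hk).le]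
  · exact h0 ⟨some j, by simpa [hK, homForm_one] using hxF j hj⟩

theorem InGeneralPosition.eventually_notMem_simplicialComplex {a₀ : Matrix (Fin d) (Fin n) ℝ}
    {b₀ : Fin n → ℝ} (hP : InGeneralPosition a₀ b₀) {F : Finset (Fin n)}
    (hF : F ∉ simplicialComplex a₀ b₀) :
    ∀ᶠ p in 𝓝 (a₀, b₀), F ∉ simplicialComplex p.1 p.2 := by
  -- Projecting this closed set along the compact sphere gives a closed set of parameters. It
  -- contains every parameter for which `F` is a simplex, but omits `(a₀, b₀)`, since there even a
  -- common zero at infinity would make `F` a simplex.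
  let T : Set ((Matrix (Fin d) (Fin n) ℝ × (Fin n → ℝ)) × Metric.sphere (0 : ℝ × (Fin d → ℝ)) 1) :=
    (⋂ k, {q | 0 ≤ homForm q.1.1 q.1.2 k q.2}) ∩
      ⋂ j ∈ F, {q | homForm q.1.1 q.1.2 (some j) q.2 = 0}
  have hcont : ∀ k, Continuous fun q : (Matrix (Fin d) (Fin n) ℝ × (Fin n → ℝ)) ×
      Metric.sphere (0 : ℝ × (Fin d → ℝ)) 1 => homForm q.1.1 q.1.2 k q.2 := fun k =>
    continuous_homForm k continuous_fst.fst continuous_fst.snd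
      (continuous_subtype_val.comp continuous_snd)
  have hT : IsClosed T :=
    (isClosed_iInter fun k => isClosed_le continuous_const (hcont k)).inter
      (isClosed_iInter fun j => isClosed_iInter fun _ =>
        isClosed_eq (hcont (some j)) continuous_const)
  have himage : IsClosed (Prod.fst '' T) := isClosedMap_fst_of_compactSpace _ hT
  have hmem : (a₀, b₀) ∉ Prod.fst '' T := by
    rintro ⟨⟨p, y⟩, ⟨h1, h2⟩, rfl⟩
    rw [Set.mem_iInter] at h1
    rw [Set.mem_iInter₂] at h2
    exact hF (hP.mem_simplicialComplex h1 (ne_zero_of_mem_unit_sphere y) h2)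
  filter_upwards [himage.isOpen_compl.mem_nhds hmem] with p hp hpF
  obtain ⟨x, hx, hxF⟩ := HalfSpaces.mem_simplicialComplex.1 hpF
  have hne : ((1, x) : ℝ × (Fin d → ℝ)) ≠ 0 := by simp
  refine hp ⟨(p, ⟨‖((1, x) : ℝ × (Fin d → ℝ))‖⁻¹ • (1, x), ?_⟩),
    ⟨Set.mem_iInter.2 fun k => ?_, Set.mem_iInter₂.2 fun j hj => ?_⟩, rfl⟩
  · rw [mem_sphere_zero_iff_norm, norm_smul, norm_inv, norm_norm,
      inv_mul_cancel₀ (norm_ne_zero_iff.2 hne)]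
  · rw [Set.mem_ofPred_eq, map_smul]
    exact mul_nonneg (inv_nonneg.2 (norm_nonneg _)) (homCone_of_form_nonneg hx k)
  · rw [Set.mem_ofPred_eq, map_smul, homForm_one, hxF j hj, smul_zero]

/-- The simplicial complex of a polyhedron in general position is stable under perturbations. -/
theorem InGeneralPosition.eventually_simplicialComplex_eq {a₀ : Matrix (Fin d) (Fin n) ℝ}
    {b₀ : Fin n → ℝ} (hP : InGeneralPosition a₀ b₀) :
    ∀ᶠ p in 𝓝 (a₀, b₀), simplicialComplex p.1 p.2 = simplicialComplex a₀ b₀ := by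
  have h : ∀ᶠ p in 𝓝 (a₀, b₀), ∀ F, F ∈ simplicialComplex p.1 p.2 ↔
      F ∈ simplicialComplex a₀ b₀ := by
    refine Filter.eventually_all.2 fun F => ?_
    by_cases hF : F ∈ simplicialComplex a₀ b₀
    · exact (hP.eventually_mem_simplicialComplex hF).mono fun p hp => iff_of_true hp hF
    · exact (hP.eventually_notMem_simplicialComplex hF).mono fun p hp => iff_of_false hp hF
  exact h.mono fun p hp => Set.ext hp

end HalfSpaces

theorem theorem14 {d n : ℕ} (a₀ : Matrix (Fin d) (Fin n) ℝ) (b₀ : Fin n → ℝ)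
    (hP : HalfSpaces.InGeneralPosition a₀ b₀)
    (J : Finset (Fin n)) (hJ : J ∈ HalfSpaces.simplicialComplex a₀ b₀) :
    ∃ U ∈ 𝓝 (a₀, b₀), ∀ a b, (a, b) ∈ U → ∀ x ∈ HalfSpaces.flat J a b,
      ∏ j ∈ Finset.univ \ J, HalfSpaces.heaviside (HalfSpaces.form a b j x) =
        ∑ F ∈ HalfSpaces.simplicesAbove a₀ b₀ J,
          ∏ j ∈ F \ J, (HalfSpaces.heaviside (HalfSpaces.form a b j x) - 1) := by
  refine ⟨_, hP.eventually_simplicialComplex_eq, fun a b hab x hx => ?_⟩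
  have hab' : HalfSpaces.simplicialComplex a b = HalfSpaces.simplicialComplex a₀ b₀ := hab
  rw [HalfSpaces.prod_heaviside_eq a b J x hx,
    HalfSpaces.sum_simplicesAbove_eq_altSum a b a₀ b₀ J x hx, ← hab',
    HalfSpaces.altSum_negIndices a b J x hx]
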